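/- Let $\Gamma$ be a metric graph, i.e. sets $V$ of vertices and $E$ of edges (of any cardinality; loops and multiple edges are allowed), where every edge $e$ is identified with a segment $[0,|e|]$, $0<|e|<\infty$, whose two ends are glued to vertices. Let $L^2(\Gamma)$ be the complex $L^2$-space for the measure induced by Lebesgue measure on the edges, and let $H^1(\Gamma)$ be the space of continuous functions $f$ on $\Gamma$ such that $f|_e\in H^1(e)$ for each edge $e$ and $\int_\Gamma(|f'|^2+|f|^2)\,dx<\infty$. Let $D\subset V$ be any set of vertices (possibly empty; $D=\{o\}$ for a tree with root $o$), and let the Laplacian $-\boldsymbol\Delta$ be the operator in $L^2(\Gamma)$ associated with the quadratic form $\int_\Gamma|f'|^2dx$ on the form domain $\{f\in H^1(\Gamma): f(v)=0 \text{ for all } v\in D\}$; that is, $f\in\mathrm{Dom}(\boldsymbol\Delta)$ and $-\boldsymbol\Delta f=w\in L^2(\Gamma)$ if and only if $f$ belongs to the form domain and $\int_\Gamma f'\,\overline{g'}\,dx=\int_\Gamma w\,\overline g\,dx$ for all $g$ in the form domain. If $\sup_{e\in E}|e|=\infty$, then the spectrum of $-\boldsymbol\Delta$, as a subset of $\mathbb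 C$, is exactly $[0,\infty)$. -/

import Mathlib

noncomputable section

/-- A metric graph with vertex set `V` and edge set `E`: every edge `e` is a non-degenerate line
segment, identified with `[0, length e]`, whose end `0` is glued to the vertex `init e` and whose
end `length e` is glued to `term e`. Loops, multiple edges, vertices of infinite degree and
infinitely many vertices and edges are allowed. -/
structure MetricGraph (V E : Type*) where
  init : E → V
  term : E → V
  length : E → ℝ
  length_pos : ∀ e, 0 < length e

namespace MetricGraph

variable {V E : Type*} (G : MetricGraph V E)

/-- Lebesgue measure on the edge `e`. -/
abbrev edgeMeasure (e : E) : MeasureTheory.Measure ℝ :=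
  MeasureTheory.volume.restrict (Set.Ioc 0 (G.length e))

/-- The Hilbert space `L²(Γ)` of complex functions on the graph that are square integrable for the
measure induced by Lebesgue measure on the edges, that is, the Hilbert sum of the `L²(e)`. -/
abbrev L2 : Type _ := lp (fun e : E => MeasureTheory.Lp ℂ 2 (G.edgeMeasure e)) 2

/-- A function on the graph is given by its values `φ` at the vertices and `f e t` at the point of
the edge `e` with coordinate `t ∈ [0, length e]`. `IsH1 φ f u p` says that this function belongs to
`H¹(Γ)`, that `u ∈ L²(Γ)` is its class and `p ∈ L²(Γ)` its derivative: on each edge it is the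
primitive of its square integrable derivative (in particular it is continuous along the edge), and
its values at the ends of the edges agree with the values at the vertices. As `u` and `p` lie in
`L²(Γ)`, the `H¹` norm is finite. A function of this kind is continuous for the path metric, since
`|f x - f y|² ≤ ρ(x, y) ∫ |f'|²`. -/
structure IsH1 (φ : V → ℂ) (f : E → ℝ → ℂ) (u p : G.L2) : Prop where
  ae_eq : ∀ e, (u e : ℝ → ℂ) =ᵐ[G.edgeMeasure e] f e
  eq_integral : ∀ e, ∀ t ∈ Set.Icc 0 (G.length e), f e t = f e 0 + ∫ s in (0 : ℝ)..t, p e s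
  at_init : ∀ e, f e 0 = φ (G.init e)
  at_term : ∀ e, f e (G.length e) = φ (G.term e)

variable {G} in
theorem intervalIntegrable_edge (p : G.L2) (e : E) {t : ℝ} (ht : t ∈ Set.Icc 0 (G.length e)) :
    IntervalIntegrable (p e : ℝ → ℂ) MeasureTheory.volume 0 t := by
  have h : MeasureTheory.IntegrableOn (p e : ℝ → ℂ) (Set.Ioc 0 (G.length e)) :=
    (MeasureTheory.Lp.memLp (p e)).integrable (by norm_num)
  rw [intervalIntegrable_iff_integrableOn_Ioc_of_le ht.1]
  exact h.mono_set (Set.Ioc_subset_Ioc_right ht.2)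

variable {G} in
theorem integral_congr_edge {e : E} {g h : ℝ → ℂ} (hgh : g =ᵐ[G.edgeMeasure e] h) {t : ℝ}
    (ht : t ∈ Set.Icc 0 (G.length e)) : ∫ s in (0 : ℝ)..t, g s = ∫ s in (0 : ℝ)..t, h s := by
  rw [intervalIntegral.integral_of_le ht.1, intervalIntegral.integral_of_le ht.1]
  exact MeasureTheory.integral_congr_ae (MeasureTheory.ae_restrict_of_ae_restrict_of_subset
    (Set.Ioc_subset_Ioc_right ht.2) hgh)

/-- The pairs `(u, u')` with `u` in the form domain: `u ∈ H¹(Γ)` and `u = 0` at the vertices in the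
set `D` (`D = {o}` for a tree with the Dirichlet condition at its root `o`, `D = ∅` for a graph
without boundary). -/
def formDomain (D : Set V) : Submodule ℂ (G.L2 × G.L2) where
  carrier := {x | ∃ φ f, G.IsH1 φ f x.1 x.2 ∧ ∀ v ∈ D, φ v = 0}
  zero_mem' := by
    refine ⟨0, 0, ⟨fun e => ?_, fun e t ht => ?_, fun _ => rfl, fun _ => rfl⟩, fun _ _ => rfl⟩
    · exact MeasureTheory.Lp.coeFn_zero ℂ 2 (G.edgeMeasure e)
    · have : ((0 : G.L2) e : ℝ → ℂ) =ᵐ[G.edgeMeasure e] 0 :=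
        MeasureTheory.Lp.coeFn_zero ℂ 2 (G.edgeMeasure e)
      simp only [Prod.snd_zero]
      rw [integral_congr_edge this ht]
      simp
  add_mem' := by
    rintro ⟨u, p⟩ ⟨v, q⟩ ⟨φ, f, hf, hφ⟩ ⟨ψ, g, hg, hψ⟩
    refine ⟨φ + ψ, f + g, ⟨fun e => ?_, fun e t ht => ?_, fun e => ?_, fun e => ?_⟩,
      fun w hw => by simp [hφ w hw, hψ w hw]⟩
    · exact (MeasureTheory.Lp.coeFn_add (u e) (v e)).trans ((hf.ae_eq e).add (hg.ae_eq e))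
    · have h : ((p + q : G.L2) e : ℝ → ℂ) =ᵐ[G.edgeMeasure e] (p e : ℝ → ℂ) + (q e : ℝ → ℂ) :=
        MeasureTheory.Lp.coeFn_add (p e) (q e)
      have h1 := hf.eq_integral e t ht
      have h2 := hg.eq_integral e t ht
      simp only [Prod.mk_add_mk, Pi.add_apply] at h1 h2 ⊢
      rw [integral_congr_edge h ht]
      simp only [Pi.add_apply]
      rw [intervalIntegral.integral_add (intervalIntegrable_edge p e ht)
        (intervalIntegrable_edge q e ht), h1, h2]
      ring
    · simp [hf.at_init e, hg.at_init e]
    · simp [hf.at_term e, hg.at_term e]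
  smul_mem' := by
    rintro c ⟨u, p⟩ ⟨φ, f, hf, hφ⟩
    refine ⟨c • φ, c • f, ⟨fun e => ?_, fun e t ht => ?_, fun e => ?_, fun e => ?_⟩,
      fun w hw => by simp [hφ w hw]⟩
    · exact (MeasureTheory.Lp.coeFn_smul c (u e)).trans ((hf.ae_eq e).const_smul c)
    · have h : ((c • p : G.L2) e : ℝ → ℂ) =ᵐ[G.edgeMeasure e] c • (p e : ℝ → ℂ) :=
        MeasureTheory.Lp.coeFn_smul c (p e)
      have h1 := hf.eq_integral e t ht
      simp only [Prod.smul_mk, Pi.smul_apply] at h1 ⊢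
      rw [integral_congr_edge h ht]
      simp only [Pi.smul_apply]
      rw [intervalIntegral.integral_smul, h1, smul_add]
    · simp [hf.at_init e]
    · simp [hf.at_term e]

/-- The graph of the operator associated with the quadratic form `∫ |u'|²` on the form domain:
`u` is in the operator domain with image `w` iff `u` is in the form domain and
`∫ conj(v') u' = ∫ conj(v) w` for all `v` in the form domain. -/
def laplacianGraph (D : Set V) : Submodule ℂ (G.L2 × G.L2) where
  carrier := {x | ∃ p, (x.1, p) ∈ G.formDomain D ∧
    ∀ v q, (v, q) ∈ G.formDomain D → inner ℂ q p = inner ℂ v x.2}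
  zero_mem' := ⟨0, (G.formDomain D).zero_mem, fun v q _ => by simp⟩
  add_mem' := by
    rintro x y ⟨p, hp, hp'⟩ ⟨q, hq, hq'⟩
    refine ⟨p + q, (G.formDomain D).add_mem hp hq, fun v r h => ?_⟩
    rw [Prod.snd_add, inner_add_right, inner_add_right, hp' v r h, hq' v r h]
  smul_mem' := by
    rintro c x ⟨p, hp, hp'⟩
    refine ⟨c • p, (G.formDomain D).smul_mem c hp, fun v r h => ?_⟩
    rw [Prod.smul_snd, inner_smul_right, inner_smul_right, hp' v r h]

variable {G} in
/-- Smooth functions with compact support inside one edge belong to the form domain. -/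
theorem exists_mem_formDomain (D : Set V) (e : E) {g : ℝ → ℝ} (hg : ContDiff ℝ 1 g)
    (hs : tsupport g ⊆ Set.Ioo 0 (G.length e)) :
    ∃ v q : G.L2, (v, q) ∈ G.formDomain D ∧
      (v e : ℝ → ℂ) =ᵐ[G.edgeMeasure e] (fun t => (g t : ℂ)) ∧ ∀ e', e' ≠ e → v e' = 0 := by
  classical
  have hmem : ∀ k : ℝ → ℂ, Continuous k → MeasureTheory.MemLp k 2 (G.edgeMeasure e) := by
    intro k hk
    obtain ⟨C, hC⟩ := isCompact_Icc.exists_bound_of_continuousOn (s := Set.Icc 0 (G.length e))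
      hk.continuousOn
    refine MeasureTheory.MemLp.of_bound hk.aestronglyMeasurable C ?_
    filter_upwards [MeasureTheory.ae_restrict_mem measurableSet_Ioc] with x hx
    exact hC x (Set.Ioc_subset_Icc_self hx)
  have hd : Continuous (deriv g) := hg.continuous_deriv le_rfl
  have hgm := hmem (fun t => (g t : ℂ)) (Complex.continuous_ofReal.comp hg.continuous)
  have hdm := hmem (fun t => ((deriv g t : ℝ) : ℂ)) (Complex.continuous_ofReal.comp hd)
  have h0 : g 0 = 0 := image_eq_zero_of_notMem_tsupport fun h => lt_irrefl _ (hs h).1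
  have h1 : g (G.length e) = 0 := image_eq_zero_of_notMem_tsupport fun h => lt_irrefl _ (hs h).2
  refine ⟨lp.single 2 e (hgm.toLp _), lp.single 2 e (hdm.toLp _),
    ⟨0, Pi.single e (fun t => (g t : ℂ)), ⟨fun e' => ?_, fun e' t ht => ?_, fun e' => ?_,
      fun e' => ?_⟩, fun _ _ => rfl⟩, ?_, fun e' he => by simp [he]⟩
  · obtain rfl | he := eq_or_ne e' e
    · simpa using hgm.coeFn_toLp
    · simpa [he] using MeasureTheory.Lp.coeFn_zero ℂ 2 (G.edgeMeasure e')
  · obtain rfl | he := eq_or_ne e' e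
    · simp only [lp.single_apply_self, Pi.single_eq_same]
      rw [integral_congr_edge hdm.coeFn_toLp ht, intervalIntegral.integral_ofReal,
        intervalIntegral.integral_deriv_eq_sub
          (fun x _ => (hg.differentiable one_ne_zero) x) (hd.intervalIntegrable _ _)]
      simp
    · have h : ((lp.single 2 e (hdm.toLp _) : G.L2) e' : ℝ → ℂ) =ᵐ[G.edgeMeasure e'] 0 := by
        simpa [he] using MeasureTheory.Lp.coeFn_zero ℂ 2 (G.edgeMeasure e')
      rw [integral_congr_edge h ht]
      simp [he]
  · obtain rfl | he := eq_or_ne e' e <;> simp [*]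
  · obtain rfl | he := eq_or_ne e' e <;> simp [*]
  · simpa using hgm.coeFn_toLp

variable {G} in
/-- The form domain is dense in `L²(Γ)`. -/
theorem eq_zero_of_orthogonal_formDomain (D : Set V) (w : G.L2)
    (hw : ∀ v q, (v, q) ∈ G.formDomain D → inner ℂ v w = 0) : w = 0 := by
  ext1
  funext e
  have hint : MeasureTheory.IntegrableOn (w e : ℝ → ℂ) (Set.Ioc 0 (G.length e)) :=
    (MeasureTheory.Lp.memLp (w e)).integrable (by norm_num)
  have key := isOpen_Ioo.ae_eq_zero_of_integral_contDiff_smul_eq_zero (U := Set.Ioo 0 (G.length e))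
    (μ := MeasureTheory.volume) (f := (w e : ℝ → ℂ))
    (hint.mono_set Set.Ioo_subset_Ioc_self).locallyIntegrableOn (by
      intro g hg _ hs
      obtain ⟨v, q, hvq, hv, hv'⟩ := exists_mem_formDomain (G := G) D e
        (hg.of_le (by exact_mod_cast le_top)) hs
      have h := hw v q hvq
      rw [lp.inner_eq_tsum, tsum_eq_single e (fun e' he => by simp [hv' e' he]),
        MeasureTheory.L2.inner_def] at h
      have h2 : ∫ x, g x • (w e : ℝ → ℂ) x ∂(G.edgeMeasure e) = 0 := by
        rw [← h]
        refine MeasureTheory.integral_congr_ae ?_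
        filter_upwards [hv] with x hx
        simp [hx, mul_comm]
      rw [← h2]
      refine (MeasureTheory.setIntegral_eq_integral_of_forall_compl_eq_zero fun x hx => ?_).symm
      rw [image_eq_zero_of_notMem_tsupport fun h => hx (Set.Ioo_subset_Ioc_self (hs h)), zero_smul])
  refine MeasureTheory.Lp.ext ?_
  refine Filter.EventuallyEq.trans ?_ (MeasureTheory.Lp.coeFn_zero ℂ 2 (G.edgeMeasure e)).symm
  have hμ : G.edgeMeasure e = MeasureTheory.volume.restrict (Set.Ioo 0 (G.length e)) :=
    (MeasureTheory.Measure.restrict_congr_set MeasureTheory.Ioo_ae_eq_Ioc).symm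
  have hae : ∀ᵐ x ∂(G.edgeMeasure e), x ∈ Set.Ioo 0 (G.length e) := by
    rw [hμ]
    exact MeasureTheory.ae_restrict_mem measurableSet_Ioo
  filter_upwards [hae, MeasureTheory.ae_restrict_of_ae key] with x hx hx'
  exact hx' hx

/-- The associated operator is single valued. -/
theorem laplacianGraph_snd_eq_zero (D : Set V) (x : G.L2 × G.L2) (hx : x ∈ G.laplacianGraph D)
    (h0 : x.1 = 0) : x.2 = 0 := by
  obtain ⟨p, hp, h⟩ := hx
  have hp0 : p = 0 := by
    have := h x.1 p hp
    rw [h0, inner_zero_left] at this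
    exact inner_self_eq_zero.1 this
  refine eq_zero_of_orthogonal_formDomain D x.2 fun v q hvq => ?_
  rw [← h v q hvq, hp0, inner_zero_right]

/-- The Laplacian `-Δ` on the graph, with Dirichlet conditions at the vertices in `D` and the
natural (Kirchhoff) conditions at all other vertices: the unbounded operator in `L²(Γ)` associated
with the quadratic form `∫ |u'|²`. -/
def laplacian (D : Set V) : G.L2 →ₗ.[ℂ] G.L2 := (G.laplacianGraph D).toLinearPMap

end MetricGraph

/-- The spectrum of an unbounded operator `A` in a Hilbert space: the complex numbers `z` for which
`A - z` has no bounded everywhere defined two-sided inverse. -/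
def LinearPMap.unboundedSpectrum {H : Type*} [NormedAddCommGroup H] [InnerProductSpace ℂ H]
    (A : H →ₗ.[ℂ] H) : Set ℂ :=
  {z | ¬ ∃ R : H →L[ℂ] H,
    (∀ y : H, ∃ x : A.domain, (x : H) = R y ∧ A x - z • (x : H) = y) ∧
    ∀ x : A.domain, R (A x - z • (x : H)) = x}

end

/-!
Point values are continuous functionals of the pair `(u, u')`, as integration by parts shows, so
the form is closed: with the form norm its domain is a Hilbert space, and the embedding `J` into
`L²(Γ)` has norm at most `1`. Solving `-Δu - zu = y` in the weak sense amounts to solving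
`(1 - (1 + z) J†J) x = J†y` in the form domain. As the spectrum of `J†J` lies in `[0, 1]`, this is
possible for every `z` outside `[0, ∞)`.

Conversely, let `k² ≥ 0`. On an edge of length `ℓ` the function `(1 - cos (2πt/ℓ)) e^{ikt}` vanishes
together with its derivative at both ends, so its extension by zero is in the domain of `-Δ`
whatever the graph is elsewhere. It satisfies `-Δu = k²u` up to a relative error `O(1/ℓ)`, which is
arbitrarily small on long edges, and so `k²` is in the spectrum.
-/

noncomputable section

open MeasureTheory Set Filter Topology
open scoped InnerProduct ComplexConjugate ComplexOrder

section UnboundedSpectrum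

variable {H : Type*} [NormedAddCommGroup H] [InnerProductSpace ℂ H] {A : H →ₗ.[ℂ] H} {z : ℂ}

theorem notMem_unboundedSpectrum_iff :
    z ∉ A.unboundedSpectrum ↔
      ∃ R : H →L[ℂ] H, ∀ u y : H, (u, y + z • u) ∈ A.graph ↔ R y = u := by
  rw [LinearPMap.unboundedSpectrum, mem_ofPred_eq, not_not]
  refine exists_congr fun R => ⟨fun ⟨hsurj, hinj⟩ u y => ⟨fun hu => ?_, ?_⟩, fun h => ⟨?_, ?_⟩⟩
  · obtain ⟨x, rfl, hx⟩ := A.mem_graph_iff.1 hu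
    simpa [hx] using hinj x
  · rintro rfl
    obtain ⟨x, hxR, hx⟩ := hsurj y
    exact A.mem_graph_iff.2 ⟨x, hxR, by rw [← hxR, ← hx, sub_add_cancel]⟩
  · intro y
    obtain ⟨x, hxR, hx⟩ := A.mem_graph_iff.1 ((h (R y) y).2 rfl)
    exact ⟨x, hxR, by rw [hx, hxR, add_sub_cancel_right]⟩
  · intro x
    exact (h _ _).1 (by simp)

theorem mem_unboundedSpectrum_of_approx_eigenvectors
    (h : ∀ ε > 0, ∃ u w : H, (u, w) ∈ A.graph ∧ u ≠ 0 ∧ ‖w - z • u‖ ≤ ε * ‖u‖) :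
    z ∈ A.unboundedSpectrum := by
  by_contra hz
  obtain ⟨R, hR⟩ := notMem_unboundedSpectrum_iff.1 hz
  obtain ⟨u, w, huw, hu, hε⟩ := h (‖R‖ + 1)⁻¹ (by positivity)
  have hRu : R (w - z • u) = u := (hR _ _).1 (by simpa using huw)
  have hle : ‖u‖ ≤ ‖R‖ * ((‖R‖ + 1)⁻¹ * ‖u‖) := by
    calc ‖u‖ = ‖R (w - z • u)‖ := by rw [hRu]
      _ ≤ ‖R‖ * ‖w - z • u‖ := R.le_opNorm _
      _ ≤ _ := by gcongr
  have hlt : ‖R‖ * ((‖R‖ + 1)⁻¹ * ‖u‖) < ‖u‖ := by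
    rw [← mul_assoc, ← div_eq_mul_inv]
    exact mul_lt_of_lt_one_left (norm_pos_iff.2 hu) ((div_lt_one (by positivity)).2 (by simp))
  exact hle.not_gt hlt

end UnboundedSpectrum

section ClosedForm

variable {H K : Type*} [NormedAddCommGroup H] [InnerProductSpace ℂ H]
  [NormedAddCommGroup K] [InnerProductSpace ℂ K]

theorem isUnit_one_sub_smul_adjoint_comp_self [CompleteSpace H] [CompleteSpace K]
    {J : K →L[ℂ] H} (hJ : ‖J‖ ≤ 1) {z : ℂ} (hz : ¬ ∃ r : ℝ, 0 ≤ r ∧ z = r) :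
    IsUnit (1 - (1 + z) • (J† ∘L J)) := by
  obtain hz0 | hz0 := eq_or_ne (1 + z) 0
  · simp [hz0]
  set T := J† ∘L J with hTdef
  suffices hspec : (1 + z)⁻¹ ∉ spectrum ℂ T by
    have hfactor : 1 - (1 + z) • T = (1 + z) • (algebraMap ℂ _ (1 + z)⁻¹ - T) := by
      rw [smul_sub, Algebra.algebraMap_eq_smul_one, smul_inv_smul₀ hz0]
    rw [hfactor]
    exact (spectrum.notMem_iff.1 hspec).smul (Units.mk0 _ hz0)
  intro hmem
  have hT : 0 ≤ T := (ContinuousLinearMap.nonneg_iff_isPositive T).2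
    (ContinuousLinearMap.isPositive_adjoint_comp_self J)
  have hTnorm : ‖T‖ ≤ 1 := by
    rw [hTdef, ContinuousLinearMap.norm_adjoint_comp_self]
    exact mul_le_one₀ hJ (norm_nonneg J) hJ
  have hnonneg : 0 ≤ (1 + z)⁻¹ := spectrum_nonneg_of_nonneg hT hmem
  obtain ⟨s, hs⟩ : ∃ s : ℝ, (s : ℂ) = (1 + z)⁻¹ := ⟨_, (Complex.eq_re_of_ofReal_le hnonneg).symm⟩
  rw [← hs] at hnonneg hmem
  have hs0 : 0 < s := (Complex.zero_le_real.1 hnonneg).lt_of_ne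
    fun h => inv_ne_zero hz0 (by rw [← hs, ← h, Complex.ofReal_zero])
  have hs1 : s ≤ 1 := by
    have := (spectrum.norm_le_norm_mul_of_mem hmem).trans
      (mul_le_mul hTnorm (ContinuousLinearMap.norm_id_le) (norm_nonneg _) zero_le_one)
    simpa [abs_of_pos hs0] using this
  exact hz ⟨s⁻¹ - 1, sub_nonneg.2 ((one_le_inv₀ hs0).2 hs1),
    by rw [Complex.ofReal_sub, Complex.ofReal_inv, hs]; simp⟩

theorem exists_resolvent_of_norm_embedding_le_one [CompleteSpace H] [CompleteSpace K]
    {J : K →L[ℂ] H} (hJ : ‖J‖ ≤ 1) {z : ℂ} (hz : ¬ ∃ r : ℝ, 0 ≤ r ∧ z = r) :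
    ∃ R : H →L[ℂ] H, ∀ u y, (∃ x, J x = u ∧
      ∀ x', inner ℂ x' x - inner ℂ (J x') (J x) = inner ℂ (J x') (y + z • J x)) ↔ R y = u := by
  obtain ⟨T, hT⟩ := isUnit_one_sub_smul_adjoint_comp_self hJ hz
  have hweak : ∀ x y, (∀ x', inner ℂ x' x - inner ℂ (J x') (J x) =
      inner ℂ (J x') (y + z • J x)) ↔ T.1 x = (J†) y := by
    intro x y
    rw [hT, ext_iff_inner_left ℂ]
    refine forall_congr' fun x' => ?_
    simp only [sub_apply, one_apply_eq_self, smul_apply, ContinuousLinearMap.comp_apply,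
      inner_sub_right, inner_smul_right, inner_add_right, ContinuousLinearMap.adjoint_inner_right]
    constructor <;> intro h <;> linear_combination h
  have hinv : ∀ x y, T.1 x = (J†) y ↔ T⁻¹.1 ((J†) y) = x := fun x y =>
    ⟨fun h => h ▸ DFunLike.congr_fun T.inv_mul x, fun h => h ▸ DFunLike.congr_fun T.mul_inv _⟩
  refine ⟨J ∘L T⁻¹.1 ∘L J†, fun u y => ⟨?_, ?_⟩⟩
  · rintro ⟨x, rfl, hx⟩
    exact congrArg J ((hinv x y).1 ((hweak x y).1 hx))
  · rintro rfl
    exact ⟨_, rfl, (hweak _ y).2 ((hinv _ y).2 rfl)⟩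

/-- The domain of a closed quadratic form `u ↦ ‖p‖²`, given as the set `F` of pairs `(u, p)`,
with the Hilbert space structure of the form norm: `‖(u, p)‖² = ‖u‖² + ‖p‖²`. -/
def formSpace (F : Submodule ℂ (H × K)) : Submodule ℂ (WithLp 2 (H × K)) :=
  F.comap (WithLp.linearEquiv 2 ℂ (H × K)).toLinearMap

/-- The embedding `(u, p) ↦ u` of the form domain, with the form norm, into the ambient space. -/
def formEmbedding (F : Submodule ℂ (H × K)) : formSpace F →L[ℂ] H :=
  WithLp.fstL 2 ℂ H K ∘L (formSpace F).subtypeL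

theorem completeSpace_formSpace [CompleteSpace H] [CompleteSpace K]
    {F : Submodule ℂ (H × K)} (hF : IsClosed (F : Set (H × K))) :
    CompleteSpace (formSpace F) :=
  (hF.preimage (WithLp.prod_continuous_ofLp 2 H K)).completeSpace_coe

theorem norm_formEmbedding_le (F : Submodule ℂ (H × K)) : ‖formEmbedding F‖ ≤ 1 :=
  ContinuousLinearMap.opNorm_le_bound _ zero_le_one fun x => by
    rw [one_mul]
    exact WithLp.norm_fst_le _ _

theorem inner_formSpace_sub_inner_formEmbedding {F : Submodule ℂ (H × K)} (x' x : formSpace F) :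
    inner ℂ x' x - inner ℂ (formEmbedding F x') (formEmbedding F x) =
      inner ℂ (x' : WithLp 2 (H × K)).snd (x : WithLp 2 (H × K)).snd :=
  sub_eq_of_eq_add' (WithLp.prod_inner_apply (x' : WithLp 2 (H × K)) x)

theorem exists_resolvent_of_isClosed [CompleteSpace H] [CompleteSpace K]
    {F : Submodule ℂ (H × K)} (hF : IsClosed (F : Set (H × K)))
    {z : ℂ} (hz : ¬ ∃ r : ℝ, 0 ≤ r ∧ z = r) :
    ∃ R : H →L[ℂ] H, ∀ u y, (∃ p, (u, p) ∈ F ∧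
      ∀ v q, (v, q) ∈ F → inner ℂ q p = inner ℂ v (y + z • u)) ↔ R y = u := by
  have := completeSpace_formSpace hF
  obtain ⟨R, hR⟩ := exists_resolvent_of_norm_embedding_le_one (norm_formEmbedding_le F) hz
  refine ⟨R, fun u y => Iff.trans ?_ (hR u y)⟩
  simp only [inner_formSpace_sub_inner_formEmbedding]
  constructor
  · rintro ⟨p, hup, hp⟩
    exact ⟨⟨WithLp.toLp 2 (u, p), hup⟩, rfl, fun x' => hp _ _ x'.2⟩
  · rintro ⟨x, rfl, hx⟩
    exact ⟨_, x.2, fun v q hvq => hx ⟨WithLp.toLp 2 (v, q), hvq⟩⟩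

end ClosedForm

section IntegrationByParts

variable {X : Type*} [NormedAddCommGroup X] [NormedSpace ℝ X] {a b : ℝ}

theorem absolutelyContinuousOnInterval_integral {f : ℝ → X}
    (hf : IntervalIntegrable f volume a b) :
    AbsolutelyContinuousOnInterval (fun x => ∫ t in a..x, f t) a b := by
  have hsub : ∀ x ∈ uIcc a b, IntervalIntegrable f volume a x := fun x hx =>
    hf.mono_set (uIcc_subset_uIcc_left hx)
  have hdist : ∀ x ∈ uIcc a b, ∀ y ∈ uIcc a b, dist (∫ t in a..x, f t) (∫ t in a..y, f t) ≤
      dist (∫ t in a..x, ‖f t‖) (∫ t in a..y, ‖f t‖) := by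
    intro x hx y hy
    rw [dist_eq_norm, dist_eq_norm, intervalIntegral.integral_interval_sub_left (hsub x hx)
      (hsub y hy), intervalIntegral.integral_interval_sub_left (hsub x hx).norm (hsub y hy).norm]
    exact intervalIntegral.norm_integral_le_abs_integral_norm
  refine squeeze_zero' (.of_forall fun _ => Finset.sum_nonneg fun _ _ => dist_nonneg) ?_
    (hf.norm.absolutelyContinuousOnInterval_intervalIntegral left_mem_uIcc)
  filter_upwards [mem_inf_of_right (mem_principal_self _)] with I hI
  exact Finset.sum_le_sum fun i hi => hdist _ (hI.1 i hi).1 _ (hI.1 i hi).2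

theorem integral_eq_sub_of_absolutelyContinuousOnInterval [CompleteSpace X] {F f : ℝ → X}
    (hF : AbsolutelyContinuousOnInterval F a b)
    (hF' : ∀ᵐ x, x ∈ uIcc a b → HasDerivAt F (f x) x) (hf : IntervalIntegrable f volume a b) :
    ∫ t in a..b, f t = F b - F a := by
  have hderiv : ∀ᵐ x, x ∈ uIcc a b → HasDerivAt (F - fun x => ∫ t in a..x, f t) 0 x := by
    filter_upwards [hF', hf.ae_hasDerivAt_integral] with x hx hx' hxab
    simpa using (hx hxab).sub (hx' hxab a left_mem_uIcc)
  obtain ⟨c, hc⟩ :=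
    (hF.sub (absolutelyContinuousOnInterval_integral hf)).const_of_ae_hasDerivAt_zero hderiv
  have h := (hc a left_mem_uIcc).trans (hc b right_mem_uIcc).symm
  simp only [Pi.sub_apply, intervalIntegral.integral_same, sub_zero] at h
  rw [h, sub_sub_cancel]

theorem integral_mul_add_primitive_mul_deriv {f m m' : ℝ → ℂ}
    (hf : IntervalIntegrable f volume a b) (c : ℂ)
    (hm : ∀ t, HasDerivAt m (m' t) t) (hm' : Continuous m') :
    ∫ t in a..b, (f t * m t + (c + ∫ s in a..t, f s) * m' t) =
      (c + ∫ s in a..b, f s) * m b - c * m a := by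
  have hprim := absolutelyContinuousOnInterval_integral hf
  have hmC1 : ContDiff ℝ 1 m := contDiff_one_iff_deriv.2
    ⟨fun t => (hm t).differentiableAt, by rwa [funext fun t => (hm t).deriv]⟩
  have hconst : AbsolutelyContinuousOnInterval (fun _ => c) a b :=
    contDiffOn_const.absolutelyContinuousOnInterval
  have h := integral_eq_sub_of_absolutelyContinuousOnInterval
    ((hconst.fun_add hprim).smul hmC1.contDiffOn.absolutelyContinuousOnInterval)
    (f := fun t => f t * m t + (c + ∫ s in a..t, f s) * m' t) ?_ ?_
  · simpa using h
  · filter_upwards [hf.ae_hasDerivAt_integral] with t ht htab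
    exact ((ht htab a left_mem_uIcc).const_add c).mul (hm t)
  · exact (hf.mul_continuousOn hmC1.continuous.continuousOn).add
      ((hconst.fun_add hprim).continuousOn.mul hm'.continuousOn).intervalIntegrable

end IntegrationByParts

theorem continuous_integral_mul_of_memLp {α : Type*} [MeasurableSpace α] {μ : Measure α}
    {k : α → ℂ} (hk : MemLp k 2 μ) : Continuous fun p : Lp ℂ 2 μ => ∫ t, p t * k t ∂μ := by
  have hinner : ∀ p : Lp ℂ 2 μ, ∫ t, p t * k t ∂μ = inner ℂ (hk.star.toLp _) p := fun p => by
    rw [L2.inner_def]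
    refine integral_congr_ae ?_
    filter_upwards [hk.star.coeFn_toLp] with t ht
    simp [ht]
  simp only [hinner]
  exact (innerSL ℂ _).continuous

theorem ae_eq_of_tendsto_Lp {α X : Type*} [MeasurableSpace α] {μ : Measure α}
    [NormedAddCommGroup X] {p : ENNReal} [Fact (1 ≤ p)] {u : ℕ → Lp X p μ} {u₀ : Lp X p μ}
    {f : ℕ → α → X} {f₀ : α → X} (hu : Tendsto u atTop (𝓝 u₀)) (huf : ∀ n, u n =ᵐ[μ] f n)
    (hf : ∀ᵐ t ∂μ, Tendsto (fun n => f n t) atTop (𝓝 (f₀ t))) : u₀ =ᵐ[μ] f₀ := by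
  obtain ⟨n, hn, hae⟩ := (tendstoInMeasure_of_tendsto_Lp hu).exists_seq_tendsto_ae
  filter_upwards [hae, ae_all_iff.2 huf, hf] with t hut hteq hft
  refine tendsto_nhds_unique hut ?_
  simp only [hteq]
  exact hft.comp hn.tendsto_atTop

namespace MetricGraph

variable {V E : Type*} {G : MetricGraph V E}

theorem memLp_edge_of_continuous (e : E) {k : ℝ → ℂ} (hk : Continuous k) :
    MemLp k 2 (G.edgeMeasure e) := by
  obtain ⟨C, hC⟩ := isCompact_Icc.exists_bound_of_continuousOn
    (s := Icc 0 (G.length e)) hk.continuousOn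
  refine MemLp.of_bound hk.aestronglyMeasurable C ?_
  filter_upwards [ae_restrict_mem measurableSet_Ioc] with t ht
  exact hC t (Ioc_subset_Icc_self ht)

theorem IsH1.integral_mul_add_integral_mul_deriv {φ : V → ℂ} {f : E → ℝ → ℂ} {u p : G.L2}
    (h : G.IsH1 φ f u p) (e : E) {m m' : ℝ → ℂ} (hm : ∀ t, HasDerivAt m (m' t) t)
    (hm' : Continuous m') :
    ∫ t, p e t * m t ∂G.edgeMeasure e + ∫ t, u e t * m' t ∂G.edgeMeasure e =
      f e (G.length e) * m (G.length e) - f e 0 * m 0 := by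
  have hℓ := (G.length_pos e).le
  have hmc : Continuous m := continuous_iff_continuousAt.2 fun t => (hm t).continuousAt
  have hint : ∀ (v : G.L2) {k : ℝ → ℂ}, Continuous k →
      Integrable (fun t => v e t * k t) (G.edgeMeasure e) := fun v k hk =>
    (Lp.memLp (v e)).integrable_mul (memLp_edge_of_continuous e hk)
  rw [← integral_add (hint p hmc) (hint u hm'), h.eq_integral e _ ⟨hℓ, le_rfl⟩,
    ← integral_mul_add_primitive_mul_deriv (intervalIntegrable_edge p e ⟨hℓ, le_rfl⟩) (f e 0)
      hm hm', intervalIntegral.integral_of_le hℓ]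
  refine integral_congr_ae ?_
  filter_upwards [h.ae_eq e, ae_restrict_mem measurableSet_Ioc] with t ht htℓ
  rw [ht, h.eq_integral e t (Ioc_subset_Icc_self htℓ)]

theorem continuous_L2_apply (e : E) : Continuous fun u : G.L2 => u e :=
  (lp.evalCLM ℂ (fun e => Lp ℂ 2 (G.edgeMeasure e)) 2 e).continuous

/-- The value at the point `t` of the edge `e` of the function on the edge with class `x.1 e` and
derivative `x.2 e`, as a functional on all pairs `x` in `L²(Γ)`: the value at `0` is obtained by
integrating `x.2 e` by parts against `1 - t / length e`. -/
def edgeValue (G : MetricGraph V E) (e : E) (t : ℝ) (x : G.L2 × G.L2) : ℂ :=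
  (∫ s, x.1 e s * (G.length e : ℂ)⁻¹ ∂G.edgeMeasure e -
    ∫ s, x.2 e s * (1 - s * (G.length e : ℂ)⁻¹) ∂G.edgeMeasure e) + ∫ s in (0 : ℝ)..t, x.2 e s

theorem continuous_edgeValue {e : E} {t : ℝ} (ht : t ∈ Icc 0 (G.length e)) :
    Continuous (G.edgeValue e t) := by
  have heval := continuous_L2_apply (G := G) e
  have hmul : ∀ {k : ℝ → ℂ}, Continuous k →
      Continuous fun p : Lp ℂ 2 (G.edgeMeasure e) => ∫ s, p s * k s ∂G.edgeMeasure e := fun hk =>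
    continuous_integral_mul_of_memLp (memLp_edge_of_continuous e hk)
  have hprim : Continuous fun p : Lp ℂ 2 (G.edgeMeasure e) => ∫ s in (0 : ℝ)..t, p s := by
    have hinner : ∀ p : Lp ℂ 2 (G.edgeMeasure e), ∫ s in (0 : ℝ)..t, p s =
        inner ℂ (indicatorConstLp 2 measurableSet_Ioc (measure_ne_top _ (Ioc 0 t)) 1) p := by
      intro p
      rw [L2.inner_indicatorConstLp_one, Measure.restrict_restrict measurableSet_Ioc,
        intervalIntegral.integral_of_le ht.1, inter_eq_left.2 (Ioc_subset_Ioc_right ht.2)]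
    simp only [hinner]
    exact (innerSL ℂ _).continuous
  exact (((hmul continuous_const).comp (heval.comp continuous_fst)).sub
    ((hmul (by fun_prop)).comp (heval.comp continuous_snd))).add
    (hprim.comp (heval.comp continuous_snd))

theorem IsH1.edgeValue_eq {φ : V → ℂ} {f : E → ℝ → ℂ} {u p : G.L2} (h : G.IsH1 φ f u p) {e : E}
    {t : ℝ} (ht : t ∈ Icc 0 (G.length e)) : G.edgeValue e t (u, p) = f e t := by
  have hℓ : (G.length e : ℂ) ≠ 0 := Complex.ofReal_ne_zero.2 (G.length_pos e).ne'
  have hm : ∀ t : ℝ, HasDerivAt (fun s : ℝ => 1 - (s : ℂ) * (G.length e : ℂ)⁻¹)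
      (-(G.length e : ℂ)⁻¹) t := fun t => by
    simpa using ((hasDerivAt_id t).ofReal_comp.mul_const (G.length e : ℂ)⁻¹).const_sub 1
  have hparts := h.integral_mul_add_integral_mul_deriv e hm continuous_const
  simp only [mul_neg, integral_neg, mul_inv_cancel₀ hℓ, Complex.ofReal_zero, zero_mul, sub_self,
    sub_zero, mul_zero, mul_one, zero_sub] at hparts
  rw [edgeValue, h.eq_integral e t ht]
  linear_combination -hparts

theorem isClosed_formDomain (D : Set V) : IsClosed (G.formDomain D : Set (G.L2 × G.L2)) := by
  refine IsSeqClosed.isClosed fun x x₀ hx hlim => ?_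
  choose φ f hH1 hD using hx
  have hf : ∀ e, ∀ t ∈ Icc 0 (G.length e),
      Tendsto (fun n => f n e t) atTop (𝓝 (G.edgeValue e t x₀)) := by
    intro e t ht
    exact (((continuous_edgeValue ht).tendsto x₀).comp hlim).congr
      fun n => (hH1 n).edgeValue_eq ht
  refine ⟨fun v => limUnder atTop fun n => φ n v, fun e t => G.edgeValue e t x₀,
    ⟨fun e => ?_, fun e t _ => ?_, fun e => ?_, fun e => ?_⟩, fun v hv => ?_⟩
  · have heval : Tendsto (fun n => (x n).1 e) atTop (𝓝 (x₀.1 e)) :=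
      (((continuous_L2_apply e).comp continuous_fst).tendsto x₀).comp hlim
    refine ae_eq_of_tendsto_Lp heval (fun n => (hH1 n).ae_eq e) ?_
    filter_upwards [ae_restrict_mem measurableSet_Ioc] with t ht
    exact hf e t (Ioc_subset_Icc_self ht)
  · simp [edgeValue]
  · simp only [← (hH1 _).at_init e]
    exact (hf e 0 ⟨le_rfl, (G.length_pos e).le⟩).limUnder_eq.symm
  · simp only [← (hH1 _).at_term e]
    exact (hf e _ ⟨(G.length_pos e).le, le_rfl⟩).limUnder_eq.symm
  · simp only [hD _ v hv]
    exact tendsto_const_nhds.limUnder_eq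

open Classical in
/-- The class in `L²(Γ)` of a continuous function on the edge `e`, extended by zero to the other
edges. -/
def onEdge (G : MetricGraph V E) (e : E) {f : ℝ → ℂ} (hf : Continuous f) : G.L2 :=
  lp.single 2 e ((memLp_edge_of_continuous e hf).toLp f)

theorem onEdge_apply_self {e : E} {f : ℝ → ℂ} (hf : Continuous f) :
    (G.onEdge e hf e : ℝ → ℂ) =ᵐ[G.edgeMeasure e] f := by
  simpa [onEdge] using (memLp_edge_of_continuous e hf).coeFn_toLp

theorem onEdge_apply_of_ne {e e' : E} (he : e' ≠ e) {f : ℝ → ℂ} (hf : Continuous f) :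
    (G.onEdge e hf e' : ℝ → ℂ) =ᵐ[G.edgeMeasure e'] 0 := by
  simpa [onEdge, he] using Lp.coeFn_zero ℂ 2 (G.edgeMeasure e')

theorem inner_onEdge (v : G.L2) {e : E} {f : ℝ → ℂ} (hf : Continuous f) :
    inner ℂ v (G.onEdge e hf) = ∫ t, f t * conj (v e t) ∂G.edgeMeasure e := by
  classical
  rw [onEdge, lp.inner_single_right, L2.inner_def]
  refine integral_congr_ae ?_
  filter_upwards [(memLp_edge_of_continuous e hf).coeFn_toLp] with t ht
  rw [ht, RCLike.inner_apply]

theorem norm_onEdge_sq {e : E} {f : ℝ → ℂ} (hf : Continuous f) :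
    ‖G.onEdge e hf‖ ^ 2 = ∫ t, ‖f t‖ ^ 2 ∂G.edgeMeasure e := by
  have h : inner ℂ (G.onEdge e hf) (G.onEdge e hf) =
      ∫ t, ((‖f t‖ ^ 2 : ℝ) : ℂ) ∂G.edgeMeasure e := by
    rw [inner_onEdge]
    refine integral_congr_ae ?_
    filter_upwards [onEdge_apply_self hf] with t ht
    rw [ht, Complex.mul_conj', Complex.ofReal_pow]
  rw [inner_self_eq_norm_sq_to_K, integral_complex_ofReal] at h
  exact Complex.ofReal_injective (by simpa using h)

theorem onEdge_sub_smul {e : E} {f g : ℝ → ℂ} (hf : Continuous f) (hg : Continuous g) (z : ℂ) :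
    G.onEdge e hg - z • G.onEdge e hf = G.onEdge e (hg.sub (hf.const_smul z)) := by
  simp only [onEdge, ← lp.single_smul, ← lp.single_sub, ← MemLp.toLp_const_smul, ← MemLp.toLp_sub]

theorem norm_onEdge_sq_le {e : E} {f : ℝ → ℂ} (hf : Continuous f) {C : ℝ}
    (hC : ∀ t, ‖f t‖ ≤ C) : ‖G.onEdge e hf‖ ^ 2 ≤ C ^ 2 * G.length e := by
  rw [norm_onEdge_sq]
  calc ∫ t, ‖f t‖ ^ 2 ∂G.edgeMeasure e
      ≤ ∫ _, C ^ 2 ∂G.edgeMeasure e :=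
        integral_mono_of_nonneg (.of_forall fun t => by positivity) (integrable_const _)
          (.of_forall fun t => pow_le_pow_left₀ (norm_nonneg _) (hC t) 2)
    _ = C ^ 2 * G.length e := by
        simp [mul_comm, (G.length_pos e).le]

theorem onEdge_mem_formDomain (D : Set V) {e : E} {f f' : ℝ → ℂ} (hf : Continuous f)
    (hderiv : ∀ t, HasDerivAt f (f' t) t) (hf' : Continuous f')
    (h0 : f 0 = 0) (hℓ : f (G.length e) = 0) :
    (G.onEdge e hf, G.onEdge e hf') ∈ G.formDomain D := by
  classical
  refine ⟨0, Pi.single e f, ⟨fun e' => ?_, fun e' t ht => ?_, fun e' => ?_, fun e' => ?_⟩,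
    fun _ _ => rfl⟩ <;> obtain rfl | he := eq_or_ne e' e
  · simpa using onEdge_apply_self hf
  · simpa [he] using onEdge_apply_of_ne he hf
  · rw [integral_congr_edge (onEdge_apply_self hf') ht,
      intervalIntegral.integral_eq_sub_of_hasDerivAt (fun t _ => hderiv t)
        (hf'.intervalIntegrable _ _)]
    simp
  · rw [integral_congr_edge (onEdge_apply_of_ne he hf') ht]
    simp [he]
  all_goals simp [*]

theorem onEdge_mem_laplacianGraph (D : Set V) {e : E} {f f' f'' : ℝ → ℂ} (hf : Continuous f)
    (hderiv : ∀ t, HasDerivAt f (f' t) t) (hderiv' : ∀ t, HasDerivAt f' (f'' t) t)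
    (hf'' : Continuous f'') (h0 : f 0 = 0) (hℓ : f (G.length e) = 0)
    (h0' : f' 0 = 0) (hℓ' : f' (G.length e) = 0) :
    (G.onEdge e hf, G.onEdge e hf''.neg) ∈ G.laplacianGraph D := by
  have hf' : Continuous f' := continuous_iff_continuousAt.2 fun t => (hderiv' t).continuousAt
  refine ⟨G.onEdge e hf', onEdge_mem_formDomain D hf hderiv hf' h0 hℓ, ?_⟩
  rintro v q ⟨φ, g, hg, -⟩
  have hparts := hg.integral_mul_add_integral_mul_deriv e (fun t => (hderiv' t).star)
    (Complex.continuous_conj.comp hf'')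
  simp only [h0', hℓ', star_zero, mul_zero, sub_zero] at hparts
  rw [inner_onEdge, inner_onEdge]
  calc ∫ t, f' t * conj (q e t) ∂G.edgeMeasure e
      = conj (∫ t, q e t * conj (f' t) ∂G.edgeMeasure e) := by
        rw [← integral_conj]; simp [mul_comm]
    _ = conj (-∫ t, v e t * conj (f'' t) ∂G.edgeMeasure e) :=
        congrArg conj (eq_neg_of_add_eq_zero_left hparts)
    _ = ∫ t, -f'' t * conj (v e t) ∂G.edgeMeasure e := by
        rw [← integral_neg, ← integral_conj]; simp [mul_comm]

/-- The function `(a + b cos θt + c sin θt) e^{ikt}`. For fixed `θ` and `k` these functions are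
closed under differentiation; `a = 1`, `b = -1`, `c = 0` and `θ = 2π / ℓ` give the plane wave of
energy `k²` cut off to an interval of length `ℓ`. -/
def trigWave (θ k : ℝ) (a b c : ℂ) (t : ℝ) : ℂ :=
  (a + b * Real.cos (θ * t) + c * Real.sin (θ * t)) * Complex.exp ((k * t : ℝ) * Complex.I)

theorem hasDerivAt_trigWave (θ k : ℝ) (a b c : ℂ) (t : ℝ) :
    HasDerivAt (trigWave θ k a b c)
      (trigWave θ k (k * Complex.I * a) (k * Complex.I * b + θ * c) (k * Complex.I * c - θ * b) t)
      t := by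
  have hθ : HasDerivAt (fun t : ℝ => θ * t) θ t := by simpa using (hasDerivAt_id t).const_mul θ
  have hk : HasDerivAt (fun t : ℝ => k * t) k t := by simpa using (hasDerivAt_id t).const_mul k
  refine (((hθ.cos.ofReal_comp.const_mul b).const_add a |>.add
    (hθ.sin.ofReal_comp.const_mul c)).mul (hk.ofReal_comp.mul_const Complex.I).cexp).congr_deriv ?_
  simp only [trigWave, Pi.add_apply]
  push_cast
  ring

theorem continuous_trigWave (θ k : ℝ) (a b c : ℂ) : Continuous (trigWave θ k a b c) :=
  continuous_iff_continuousAt.2 fun t => (hasDerivAt_trigWave θ k a b c t).continuousAt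

theorem norm_trigWave (θ k : ℝ) (a b c : ℂ) (t : ℝ) :
    ‖trigWave θ k a b c t‖ = ‖a + b * Real.cos (θ * t) + c * Real.sin (θ * t)‖ := by
  rw [trigWave, norm_mul, Complex.norm_exp_ofReal_mul_I, mul_one]

theorem norm_trigWave_le (θ k : ℝ) (a b c : ℂ) (t : ℝ) :
    ‖trigWave θ k a b c t‖ ≤ ‖a‖ + ‖b‖ + ‖c‖ := by
  rw [norm_trigWave]
  refine norm_add₃_le.trans ?_
  rw [norm_mul, norm_mul, Complex.norm_real, Complex.norm_real]
  gcongr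
  · exact mul_le_of_le_one_right (norm_nonneg b) (Real.abs_cos_le_one _)
  · exact mul_le_of_le_one_right (norm_nonneg c) (Real.abs_sin_le_one _)

theorem length_le_norm_onEdge_trigWave_sq (k : ℝ) (e : E) :
    G.length e ≤
      ‖G.onEdge e (continuous_trigWave (2 * Real.pi / G.length e) k 1 (-1) 0)‖ ^ 2 := by
  have hℓ := G.length_pos e
  set θ := 2 * Real.pi / G.length e
  have hθ : θ ≠ 0 := (div_pos Real.two_pi_pos hℓ).ne'
  have hθℓ : θ * G.length e = 2 * Real.pi := div_mul_cancel₀ _ hℓ.ne'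
  have hnorm : ∀ t, ‖trigWave θ k 1 (-1) 0 t‖ ^ 2 = (1 - Real.cos (θ * t)) ^ 2 := fun t => by
    rw [norm_trigWave, ← sq_abs (1 - _), ← Real.norm_eq_abs, ← Complex.norm_real]
    simp [sub_eq_add_neg]
  rw [norm_onEdge_sq]
  simp only [hnorm]
  rw [← intervalIntegral.integral_of_le hℓ.le]
  calc G.length e = ∫ t in (0 : ℝ)..G.length e, (1 - 2 * Real.cos (θ * t)) := by
        rw [intervalIntegral.integral_sub (by simp)
          (Continuous.intervalIntegrable (by fun_prop) _ _), intervalIntegral.integral_const_mul,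
          intervalIntegral.integral_comp_mul_left _ hθ, hθℓ]
        simp
    _ ≤ ∫ t in (0 : ℝ)..G.length e, (1 - Real.cos (θ * t)) ^ 2 := by
        refine intervalIntegral.integral_mono_on hℓ.le
          (Continuous.intervalIntegrable (by fun_prop) _ _)
          (Continuous.intervalIntegrable (by fun_prop) _ _) fun t _ => ?_
        nlinarith [sq_nonneg (Real.cos (θ * t))]

theorem exists_quasimode (D : Set V) (k : ℝ) (e : E) :
    ∃ u w, (u, w) ∈ G.laplacianGraph D ∧ u ≠ 0 ∧ ‖w - ((k ^ 2 : ℝ) : ℂ) • u‖ ≤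
      ((2 * Real.pi / G.length e) ^ 2 + 2 * |k| * (2 * Real.pi / G.length e)) * ‖u‖ := by
  have hℓ := G.length_pos e
  set θ := 2 * Real.pi / G.length e
  have hθ : 0 < θ := div_pos Real.two_pi_pos hℓ
  have hθℓ : θ * G.length e = 2 * Real.pi := div_mul_cancel₀ _ hℓ.ne'
  have hf := continuous_trigWave θ k 1 (-1) 0
  have hu : G.length e ≤ ‖G.onEdge e hf‖ ^ 2 := length_le_norm_onEdge_trigWave_sq k e
  refine ⟨G.onEdge e hf, G.onEdge e (continuous_trigWave ..).neg,
    onEdge_mem_laplacianGraph D hf (hasDerivAt_trigWave θ k 1 (-1) 0)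
      (hasDerivAt_trigWave θ k _ _ _) (continuous_trigWave ..) ?_ ?_ ?_ ?_, ?_, ?_⟩
  any_goals (simp [trigWave, hθℓ]; done)
  · intro h0
    rw [h0, norm_zero] at hu
    linarith
  · rw [onEdge_sub_smul]
    refine le_of_sq_le_sq ((norm_onEdge_sq_le _ (C := θ ^ 2 + 2 * |k| * θ) fun t => ?_).trans ?_)
      (by positivity)
    · calc _ = ‖trigWave θ k 0 (-θ ^ 2) (-(2 * k * θ * Complex.I)) t‖ := ?_
        _ ≤ ‖(0 : ℂ)‖ + ‖-(θ : ℂ) ^ 2‖ + ‖-(2 * k * θ * Complex.I)‖ := norm_trigWave_le ..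
        _ = θ ^ 2 + 2 * |k| * θ := by simp [abs_of_pos hθ]
      congr 1
      change -trigWave .. - ((k ^ 2 : ℝ) : ℂ) * trigWave .. = _
      simp only [trigWave]
      push_cast
      linear_combination
        -(k ^ 2 * (1 - Complex.cos (θ * t)) * Complex.exp (k * t * Complex.I)) * Complex.I_sq
    · rw [mul_pow]
      gcongr

theorem laplacian_graph (D : Set V) : (G.laplacian D).graph = G.laplacianGraph D :=
  Submodule.toLinearPMap_graph_eq _ (G.laplacianGraph_snd_eq_zero D)

theorem notMem_unboundedSpectrum_laplacian (D : Set V) {z : ℂ} (hz : ¬ ∃ r : ℝ, 0 ≤ r ∧ z = r) :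
    z ∉ (G.laplacian D).unboundedSpectrum := by
  rw [notMem_unboundedSpectrum_iff, laplacian_graph]
  exact exists_resolvent_of_isClosed (isClosed_formDomain D) hz

theorem ofReal_mem_unboundedSpectrum_laplacian (D : Set V)
    (hG : ¬ BddAbove (range G.length)) {r : ℝ} (hr : 0 ≤ r) :
    (r : ℂ) ∈ (G.laplacian D).unboundedSpectrum := by
  refine mem_unboundedSpectrum_of_approx_eigenvectors fun ε hε => ?_
  have herror : Tendsto (fun ℓ : ℝ => (2 * Real.pi / ℓ) ^ 2 + 2 * |√r| * (2 * Real.pi / ℓ))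
      atTop (𝓝 0) := by
    have hθ : Tendsto (fun ℓ : ℝ => 2 * Real.pi / ℓ) atTop (𝓝 0) :=
      tendsto_const_nhds.div_atTop tendsto_id
    simpa using (hθ.pow 2).add (hθ.const_mul (2 * |√r|))
  obtain ⟨N, hN⟩ := eventually_atTop.1 (herror.eventually_le_const hε)
  obtain ⟨_, ⟨e, rfl⟩, he⟩ := not_bddAbove_iff.1 hG N
  obtain ⟨u, w, huw, hu, hle⟩ := exists_quasimode D √r e
  rw [Real.sq_sqrt hr] at hle
  exact ⟨u, w, by rwa [laplacian_graph], hu, hle.trans (by gcongr; exact hN _ he.le)⟩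

end MetricGraph

end

theorem theorem5p2 {V E : Type*} (G : MetricGraph V E) (D : Set V)
    (hG : ¬ BddAbove (Set.range G.length)) :
    (G.laplacian D).unboundedSpectrum = {z : ℂ | ∃ r : ℝ, 0 ≤ r ∧ z = r} := by
  refine Set.Subset.antisymm (fun z hz => ?_) ?_
  · by_contra hneg
    exact MetricGraph.notMem_unboundedSpectrum_laplacian D hneg hz
  · rintro _ ⟨r, hr, rfl⟩
    exact MetricGraph.ofReal_mem_unboundedSpectrum_laplacian D hG hr
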